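/- Let $A,B$ be complex $n\times n$ matrices with $mI\le A\le MI$ and $mI\le B\le MI$ in the Loewner order for some scalars $0<m<M$, let $0\le v\le 1$ and $p>0$. Let $\sigma_v$ be an operator mean in the sense of Kubo and Ando (jointly monotone, satisfying the transformer inequality $C(X\sigma_v Y)C\le (CXC)\sigma_v(CYC)$ for $C\ge 0$, continuous along decreasing sequences, and with $I\sigma_v I=I$) which lies between the weighted harmonic and arithmetic means: $$\big((1-v)X^{-1}+vY^{-1}\big)^{-1}\le X\sigma_v Y\le (1-v)X+vY\quad\text{for all positive definite } X,Y .$$ Then for every unitarily invariant norm $\|\cdot\|$ on the $n\times n$ matrices, $$L^{-1/p}\,\big\|e^{A\nabla_vB}\big\|\;\le\;\Big\|\big(e^{pA}\,\sigma_v\, e^{pB}\big)^{1/p}\Big\|\;\le\; L^{1/p}\,\big\|e^{A\nabla_vB}\big\|,$$ where $L=L(e^{pm},e^{pM})$ and, for $a,b>0$, $$L(a,b)=\frac{(a\nabla_\lambda b)\,(a\sharp_\mu b)}{(a\sharp_\lambda b)\,(a\,!_\mu\, b)},\qquad \lambda=\min\{v,1-v\},\quad \mu=\max\{v,1-v\}.$$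 Here $X\nabla_vY=(1-v)X+vY$ for matrices, and for positive reals $a\nabla_t b=(1-t)a+tb$, $a\sharp_t b=a^{1-t}b^{t}$, $a\,!_t\,b=\big((1-t)a^{-1}+tb^{-1}\big)^{-1}$. -/

import Mathlib

open scoped ComplexOrder MatrixOrder Topology

/-- The weighted arithmetic mean `a ∇_v b = (1 - v) a + v b` of two real numbers. -/
noncomputable def scalarArith (v a b : ℝ) : ℝ := (1 - v) * a + v * b

/-- The weighted geometric mean `a ♯_v b = a ^ (1 - v) b ^ v` of two (positive) real numbers. -/
noncomputable def scalarGeom (v a b : ℝ) : ℝ := a ^ (1 - v) * b ^ v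

/-- The weighted harmonic mean `a !_v b = ((1 - v) a⁻¹ + v b⁻¹)⁻¹` of two (positive) reals. -/
noncomputable def scalarHarm (v a b : ℝ) : ℝ := ((1 - v) * a⁻¹ + v * b⁻¹)⁻¹

/-- The constant `L(a, b) = ((a ∇_l b) (a ♯_u b)) / ((a ♯_l b) (a !_u b))`, where
`l = min {v, 1 - v}` and `u = max {v, 1 - v}`. -/
noncomputable def meanConst (v a b : ℝ) : ℝ :=
  (scalarArith (min v (1 - v)) a b * scalarGeom (max v (1 - v)) a b) /
    (scalarGeom (min v (1 - v)) a b * scalarHarm (max v (1 - v)) a b)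

/-- The weighted arithmetic mean `A ∇_v B = (1 - v) A + v B` of two matrices. -/
noncomputable def matArith {n : ℕ} (v : ℝ) (A B : Matrix (Fin n) (Fin n) ℂ) :
    Matrix (Fin n) (Fin n) ℂ :=
  (1 - v) • A + v • B

/-- The weighted harmonic mean `A !_v B = ((1 - v) A⁻¹ + v B⁻¹)⁻¹` of two (positive definite)
matrices. -/
noncomputable def matHarm {n : ℕ} (v : ℝ) (A B : Matrix (Fin n) (Fin n) ℂ) :
    Matrix (Fin n) (Fin n) ℂ :=
  ((1 - v) • A⁻¹ + v • B⁻¹)⁻¹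

/-- Operator means in the sense of Kubo and Ando, on positive semidefinite `n × n` matrices for
the Loewner order. The values of `σ` at other matrices are irrelevant. The axioms are asked for in
the given dimension only, so every operator mean on a Hilbert space that contains `ℂⁿ` restricts to
such a `σ`. In the continuity axiom, decreasing limits are limits of antitone sequences. -/
structure IsOperatorMean {n : ℕ}
    (σ : Matrix (Fin n) (Fin n) ℂ → Matrix (Fin n) (Fin n) ℂ → Matrix (Fin n) (Fin n) ℂ) :
    Prop where
  nonneg : ∀ A B, 0 ≤ A → 0 ≤ B → 0 ≤ σ A B
  mono : ∀ A B C D, 0 ≤ A → 0 ≤ B → A ≤ C → B ≤ D → σ A B ≤ σ C D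
  transformer : ∀ A B C, 0 ≤ A → 0 ≤ B → 0 ≤ C → C * σ A B * C ≤ σ (C * A * C) (C * B * C)
  continuous_above : ∀ (a b : ℕ → Matrix (Fin n) (Fin n) ℂ) (A B : Matrix (Fin n) (Fin n) ℂ),
    (∀ k, 0 ≤ a k) → (∀ k, 0 ≤ b k) → Antitone a → Antitone b →
    Filter.Tendsto a Filter.atTop (𝓝 A) → Filter.Tendsto b Filter.atTop (𝓝 B) →
    Filter.Tendsto (fun k => σ (a k) (b k)) Filter.atTop (𝓝 (σ A B))
  one_one : σ 1 1 = 1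

/-- `A !_v B ≤ A σ B ≤ A ∇_v B` for all positive definite `A`, `B`. -/
def IsBetweenHarmArith {n : ℕ} (v : ℝ)
    (σ : Matrix (Fin n) (Fin n) ℂ → Matrix (Fin n) (Fin n) ℂ → Matrix (Fin n) (Fin n) ℂ) : Prop :=
  ∀ A B, A.PosDef → B.PosDef → matHarm v A B ≤ σ A B ∧ σ A B ≤ matArith v A B

/-- A seminorm on `n × n` matrices is a unitarily invariant norm if it is definite and
`‖U X V‖ = ‖X‖` for all unitary `U`, `V`. -/
structure IsUnitarilyInvariantNorm {n : ℕ} (N : Seminorm ℂ (Matrix (Fin n) (Fin n) ℂ)) :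
    Prop where
  eq_zero : ∀ X, N X = 0 → X = 0
  unitary_mul_mul : ∀ U ∈ Matrix.unitaryGroup (Fin n) ℂ, ∀ V ∈ Matrix.unitaryGroup (Fin n) ℂ,
    ∀ X, N (U * X * V) = N X

/-!
The proof works with logarithms. Put `X = exp (p A)`, `Y = exp (p B)` and `Z = X σ Y`, so that
`X !_v Y ≤ Z ≤ X ∇_v Y`, and let `L` be the constant of the theorem.

* Since `log` is operator concave, `p (A ∇_v B) ≤ log (X ∇_v Y)` (`arith_le_log_arith_exp`). The
  same inequality for `-A` and `-B` reads `log (X !_v Y) ≤ p (A ∇_v B)` (`log_harm_exp_le_arith`).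
* `X ∇_v Y ≤ L (X !_v Y)` (`arith_le_smul_harm`). Conjugation by `X ^ (-1/2)` reduces this to `X = 1`
  and, by functional calculus in `Y`, to the inequality between real numbers
  `scalarArith_mul_le_meanConst`.
* As `log` is operator monotone, these give `± (log Z - p (A ∇_v B)) ≤ log L` in the Loewner order
  (`log_mean_exp_sub_arith_bounds`).

Finally `Z ^ (1 / p) = exp ((1 / p) log Z)`, and a unitarily invariant norm of `exp S` is monotone in
the Hermitian matrix `S` (`IsUnitarilyInvariantNorm.exp_mono`), although `exp` is not operator
monotone: the eigenvalues of `S`, in decreasing order, are monotone in `S` by Weyl's principle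
(`Matrix.IsHermitian.eigenvalues_mono`), and the norm is monotone on nonnegative diagonal matrices
(`IsUnitarilyInvariantNorm.diagonal_mono`).
-/

/-! ### The inequality between real numbers -/

section Scalar

/-- This is `artanh (r x) ≤ r artanh x`, read off term by term from the power series of `artanh`. -/
theorem one_add_div_one_sub_le_rpow {r x : ℝ} (hr0 : 0 ≤ r) (hr1 : r ≤ 1) (hx0 : 0 ≤ x)
    (hx1 : x < 1) : (1 + r * x) / (1 - r * x) ≤ ((1 + x) / (1 - x)) ^ r := by
  have hrx0 : 0 ≤ r * x := mul_nonneg hr0 hx0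
  have hrx1 : r * x < 1 := (mul_le_of_le_one_left hx0 hr1).trans_lt hx1
  have hlog : Real.log (1 + r * x) - Real.log (1 - r * x) ≤
      r * (Real.log (1 + x) - Real.log (1 - x)) := by
    refine hasSum_le (fun k => ?_)
      (Real.hasSum_log_sub_log_of_abs_lt_one (by rwa [abs_of_nonneg hrx0]))
      ((Real.hasSum_log_sub_log_of_abs_lt_one (by rwa [abs_of_nonneg hx0])).mul_left r)
    have h : r ^ (2 * k + 1) ≤ r := pow_le_of_le_one hr0 hr1 (by omega)
    rw [mul_pow, mul_left_comm r]
    gcongr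
  rw [← Real.log_le_log_iff (by apply div_pos <;> linarith)
    (Real.rpow_pos_of_pos (by apply div_pos <;> linarith) _),
    Real.log_rpow (by apply div_pos <;> linarith), Real.log_div (by linarith) (by linarith),
    Real.log_div (by linarith) (by linarith)]
  exact hlog

/-- The substitution `x = (t - 1) / (t + 1)`, `r = 1 - 2 l` turns this into
`one_add_div_one_sub_le_rpow`. -/
theorem scalarArith_swap_le {l t : ℝ} (hl0 : 0 ≤ l) (hl : l ≤ 1 / 2) (ht : 1 ≤ t) :
    scalarArith l t 1 ≤ scalarArith l 1 t * t ^ (1 - 2 * l) := by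
  have h := one_add_div_one_sub_le_rpow (r := 1 - 2 * l) (x := (t - 1) / (t + 1)) (by linarith)
    (by linarith) (by apply div_nonneg <;> linarith) (by rw [div_lt_one] <;> linarith)
  have h1 : (1 + (t - 1) / (t + 1)) / (1 - (t - 1) / (t + 1)) = t := by
    field_simp
    ring
  have hpos : 0 < scalarArith l 1 t := by
    unfold scalarArith
    nlinarith
  have h2 : (1 + (1 - 2 * l) * ((t - 1) / (t + 1))) / (1 - (1 - 2 * l) * ((t - 1) / (t + 1))) =
      scalarArith l t 1 / scalarArith l 1 t := by
    have hne := hpos.ne'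
    have hd : 1 - (1 - 2 * l) * ((t - 1) / (t + 1)) = 2 * scalarArith l 1 t / (t + 1) := by
      unfold scalarArith
      field_simp
      ring
    rw [hd]
    have ht' : t + 1 ≠ 0 := by linarith
    field_simp
    unfold scalarArith
    ring
  rw [h1, h2, div_le_iff₀ hpos] at h
  linarith

/-- The case `X = 1`, `Y = x` of `X ∇_v Y ≤ L (X !_v Y)`. The left side is largest at the endpoint
`x = b / a`, where the comparison with `meanConst` is `scalarArith_swap_le`. -/
theorem scalarArith_mul_le_meanConst {v a b x : ℝ} (hv0 : 0 ≤ v) (hv1 : v ≤ 1) (ha : 0 < a)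
    (hab : a ≤ b) (hx : a / b ≤ x) (hx' : x ≤ b / a) :
    scalarArith v 1 x * scalarArith v 1 x⁻¹ ≤ meanConst v a b := by
  have hb : 0 < b := ha.trans_le hab
  have hx0 : 0 < x := (div_pos ha hb).trans_le hx
  obtain ⟨l, hl⟩ : ∃ l, l = min v (1 - v) := ⟨_, rfl⟩
  have hmax : max v (1 - v) = 1 - l := by
    have := min_add_max v (1 - v)
    linarith
  have hl0 : 0 ≤ l := by rw [hl]; exact le_min hv0 (by linarith)
  have hl2 : l ≤ 1 / 2 := by
    rcases le_total v (1 - v) with h | h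
    · rw [hl, min_eq_left h]; linarith
    · rw [hl, min_eq_right h]; linarith
  have hvl : v * (1 - v) = l * (1 - l) := by
    rcases le_total v (1 - v) with h | h
    · rw [hl, min_eq_left h]
    · rw [hl, min_eq_right h]; ring
  obtain ⟨t, htdef⟩ : ∃ t, t = b / a := ⟨_, rfl⟩
  have hbt : b = a * t := by rw [htdef]; field_simp
  have ht : 1 ≤ t := by rw [htdef, one_le_div ha]; exact hab
  have ht0 : 0 < t := by linarith
  have hP : 0 < scalarArith l 1 t := by unfold scalarArith; nlinarith
  -- `L = (1 ∇_l t)² t ^ (-2 l)` for `t = b / a` and `l = min {v, 1 - v}`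
  have hL : meanConst v a b = scalarArith l 1 t * (scalarArith l 1 t * t ^ (1 - 2 * l)) / t := by
    have h1 : scalarArith l a b = a * scalarArith l 1 t := by
      unfold scalarArith; rw [hbt]; ring
    have h2 : scalarHarm (1 - l) a b = a * t / scalarArith l 1 t := by
      have hne := hP.ne'
      unfold scalarHarm
      unfold scalarArith at hne ⊢
      rw [hbt, inv_eq_iff_eq_inv, inv_div]
      field_simp
      ring
    have h3 : scalarGeom (1 - l) a b = scalarGeom l a b * t ^ (1 - 2 * l) := by
      unfold scalarGeom
      rw [hbt, Real.mul_rpow ha.le ht0.le, Real.mul_rpow ha.le ht0.le,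
        show (1 - l) = l + (1 - 2 * l) by ring, Real.rpow_add ha, Real.rpow_add ht0,
        show 1 - (l + (1 - 2 * l)) = l by ring]
      ring
    have h4 : scalarGeom l a b ≠ 0 :=
      (mul_pos (Real.rpow_pos_of_pos ha _) (Real.rpow_pos_of_pos hb _)).ne'
    rw [meanConst, hmax, ← hl, h1, h2, h3]
    field_simp
  have hxt : x + x⁻¹ ≤ t + t⁻¹ := by
    have h1 : 1 ≤ t * x := by
      rw [htdef]
      have := mul_le_mul_of_nonneg_left hx (div_pos hb ha).le
      rwa [div_mul_div_cancel₀ ha.ne', div_self hb.ne'] at this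
    have h2 : x ≤ t := htdef ▸ hx'
    have : t + t⁻¹ - (x + x⁻¹) = (t - x) * (t * x - 1) / (t * x) := by
      field_simp
      ring
    have h3 : 0 ≤ (t - x) * (t * x - 1) / (t * x) :=
      div_nonneg (mul_nonneg (by linarith) (by linarith)) (by positivity)
    linarith
  calc scalarArith v 1 x * scalarArith v 1 x⁻¹
      = 1 - 2 * (v * (1 - v)) + v * (1 - v) * (x + x⁻¹) := by
        unfold scalarArith; field_simp; ring
    _ ≤ 1 - 2 * (v * (1 - v)) + v * (1 - v) * (t + t⁻¹) := by
        have : 0 ≤ v * (1 - v) := mul_nonneg hv0 (by linarith)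
        gcongr
    _ = scalarArith l 1 t * scalarArith l t 1 / t := by
        rw [hvl]; unfold scalarArith; field_simp; ring
    _ ≤ meanConst v a b := by
        rw [hL]
        gcongr
        exact scalarArith_swap_le hl0 hl2 ht

theorem meanConst_pos {v a b : ℝ} (hv0 : 0 ≤ v) (hv1 : v ≤ 1) (ha : 0 < a) (hab : a ≤ b) :
    0 < meanConst v a b := by
  have hb : 0 < b := ha.trans_le hab
  have h := scalarArith_mul_le_meanConst hv0 hv1 ha hab (x := 1) ((div_le_one hb).2 hab)
    ((one_le_div ha).2 hab)
  have h1 : scalarArith v 1 1 = 1 := by unfold scalarArith; ring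
  rw [inv_one, h1] at h
  linarith

end Scalar

/-! ### Unitarily invariant norms on diagonal matrices -/

section Norm

variable {n : ℕ}

theorem diagonal_mem_unitaryGroup_of_mul_self_eq_one {ε : Fin n → ℝ} (hε : ∀ i, ε i * ε i = 1) :
    Matrix.diagonal (fun i => (ε i : ℂ)) ∈ Matrix.unitaryGroup (Fin n) ℂ := by
  rw [Matrix.mem_unitaryGroup_iff, Matrix.star_eq_conjTranspose, Matrix.diagonal_conjTranspose,
    Matrix.diagonal_mul_diagonal, ← Matrix.diagonal_one]
  congr 1
  ext i
  simp [← Complex.ofReal_mul, hε]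

namespace IsUnitarilyInvariantNorm

variable {N : Seminorm ℂ (Matrix (Fin n) (Fin n) ℂ)} (hN : IsUnitarilyInvariantNorm N)

include hN

/-- Shrinking one entry: the new diagonal matrix is a convex combination of the old one and of the
old one with the sign of that entry flipped, which is a multiple of it by a unitary. -/
theorem diagonal_update_le (e : Fin n → ℝ) (i : Fin n) {θ : ℝ} (h0 : 0 ≤ θ) (h1 : θ ≤ 1) :
    N (Matrix.diagonal fun j => ((Function.update e i (θ * e i) j : ℝ) : ℂ)) ≤
      N (Matrix.diagonal fun j => (e j : ℂ)) := by
  set ε : Fin n → ℝ := Function.update 1 i (-1) with hε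
  set E : Matrix (Fin n) (Fin n) ℂ := Matrix.diagonal fun j => (e j : ℂ)
  set F : Matrix (Fin n) (Fin n) ℂ := Matrix.diagonal fun j => (ε j : ℂ)
  have hF : F ∈ Matrix.unitaryGroup (Fin n) ℂ :=
    diagonal_mem_unitaryGroup_of_mul_self_eq_one fun j => by
      by_cases h : j = i
      · subst h; simp [hε]
      · simp [hε, h]
  have hEq : (Matrix.diagonal fun j => ((Function.update e i (θ * e i) j : ℝ) : ℂ)) =
      (((1 + θ) / 2 : ℝ) : ℂ) • E + (((1 - θ) / 2 : ℝ) : ℂ) • (F * E * 1) := by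
    rw [mul_one, Matrix.diagonal_mul_diagonal, ← Matrix.diagonal_smul, ← Matrix.diagonal_smul,
      Matrix.diagonal_add]
    congr 1
    ext j
    by_cases h : j = i
    · subst h
      simp [hε]
      ring
    · simp [hε, h]
      ring
  rw [hEq]
  refine (map_add_le_add N _ _).trans (le_of_eq ?_)
  rw [map_smul_eq_mul, map_smul_eq_mul, hN.unitary_mul_mul F hF 1 (one_mem _), Complex.norm_real,
    Complex.norm_real, Real.norm_of_nonneg (by linarith), Real.norm_of_nonneg (by linarith)]
  ring

theorem diagonal_mono {d e : Fin n → ℝ} (hd : ∀ i, 0 ≤ d i) (hde : ∀ i, d i ≤ e i) :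
    N (Matrix.diagonal fun j => (d j : ℂ)) ≤ N (Matrix.diagonal fun j => (e j : ℂ)) := by
  have key (s : Finset (Fin n)) :
      N (Matrix.diagonal fun j => ((if j ∈ s then d j else e j : ℝ) : ℂ)) ≤
        N (Matrix.diagonal fun j => (e j : ℂ)) := by
    induction s using Finset.induction_on with
    | empty => simp
    | insert i s hi ih =>
      -- if `e i = 0` then `d i = 0` as well, and `θ = 0 / 0 = 0` serves
      refine le_trans (le_of_eq ?_) ((hN.diagonal_update_le
        (fun j => if j ∈ s then d j else e j) i (θ := d i / e i)
        (div_nonneg (hd i) ((hd i).trans (hde i)))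
        (div_le_one_of_le₀ (hde i) ((hd i).trans (hde i)))).trans ih)
      congr 2
      ext j
      by_cases h : j = i
      · subst h
        rcases eq_or_ne (e j) 0 with h0 | h0
        · have : d j = 0 := le_antisymm (h0 ▸ hde j) (hd j)
          simp [hi, this]
        · simp [hi, h0]
      · simp [h]
  simpa using key Finset.univ

theorem apply_cfc {S : Matrix (Fin n) (Fin n) ℂ} (hS : S.IsHermitian) (f : ℝ → ℝ) :
    N (cfc f S) = N (Matrix.diagonal fun j => (f (hS.eigenvalues j) : ℂ)) := by
  rw [hS.cfc_eq, Matrix.IsHermitian.cfc, Unitary.conjStarAlgAut_apply]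
  exact hN.unitary_mul_mul _ hS.eigenvectorUnitary.2 _ (star hS.eigenvectorUnitary).2 _

end IsUnitarilyInvariantNorm

end Norm

/-! ### Weyl's monotonicity principle -/

section Weyl

open scoped Matrix Matrix.Norms.L2Operator

variable {n : ℕ}

theorem Matrix.IsHermitian.star_dotProduct_mulVec_eq_sum {S : Matrix (Fin n) (Fin n) ℂ}
    (hS : S.IsHermitian) (x : Fin n → ℂ) :
    star x ⬝ᵥ (S *ᵥ x) = ((∑ j, hS.eigenvalues j *
      ‖((star hS.eigenvectorUnitary : Matrix (Fin n) (Fin n) ℂ) *ᵥ x) j‖ ^ 2 : ℝ) : ℂ) := by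
  set U : Matrix (Fin n) (Fin n) ℂ := ↑hS.eigenvectorUnitary
  have hSU : S = U * diagonal (RCLike.ofReal ∘ hS.eigenvalues) * star U := by
    conv_lhs => rw [hS.spectral_theorem, Unitary.conjStarAlgAut_apply]
  have h1 : star x ⬝ᵥ (S *ᵥ x) =
      star (star U *ᵥ x) ⬝ᵥ (diagonal (RCLike.ofReal ∘ hS.eigenvalues) *ᵥ (star U *ᵥ x)) := by
    conv_lhs => rw [hSU]
    rw [star_mulVec, ← star_eq_conjTranspose, star_star, ← dotProduct_mulVec, mulVec_mulVec,
      mulVec_mulVec, mul_assoc]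
  rw [h1, dotProduct]
  push_cast
  refine Finset.sum_congr rfl fun j _ => ?_
  rw [mulVec_diagonal, Pi.star_apply, mul_left_comm, RCLike.star_def, Complex.conj_mul']
  rfl

theorem Matrix.IsHermitian.sum_norm_sq_eigenvectorUnitary_mulVec {S : Matrix (Fin n) (Fin n) ℂ}
    (hS : S.IsHermitian) (x : Fin n → ℂ) :
    ((∑ j, ‖((star hS.eigenvectorUnitary : Matrix (Fin n) (Fin n) ℂ) *ᵥ x) j‖ ^ 2 : ℝ) : ℂ) =
      star x ⬝ᵥ x := by
  set U : Matrix (Fin n) (Fin n) ℂ := ↑hS.eigenvectorUnitary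
  have hU : U * star U = 1 := Unitary.mul_star_self_of_mem hS.eigenvectorUnitary.2
  have h1 : star x ⬝ᵥ x = star (star U *ᵥ x) ⬝ᵥ (star U *ᵥ x) := by
    rw [star_mulVec, ← star_eq_conjTranspose, star_star, ← dotProduct_mulVec, mulVec_mulVec, hU,
      one_mulVec]
  rw [h1, dotProduct]
  push_cast
  refine Finset.sum_congr rfl fun j _ => ?_
  rw [Pi.star_apply, RCLike.star_def, Complex.conj_mul']

/-- Weyl's monotonicity principle. Mathlib indexes eigenvalues through a bijection that makes them
decreasing, and it is the same bijection for `S` and for `T`. -/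
theorem Matrix.IsHermitian.eigenvalues_mono {S T : Matrix (Fin n) (Fin n) ℂ}
    (hS : S.IsHermitian) (hT : T.IsHermitian) (hST : S ≤ T) (i : Fin n) :
    hS.eigenvalues i ≤ hT.eigenvalues i := by
  set e : Fin n ≃ Fin (Fintype.card (Fin n)) :=
    (Fintype.equivOfCardEq (Fintype.card_fin _)).symm
  have anti {R : Matrix (Fin n) (Fin n) ℂ} (hR : R.IsHermitian) {j k : Fin n} (h : e j ≤ e k) :
      hR.eigenvalues k ≤ hR.eigenvalues j := hR.eigenvalues₀_antitone h
  set U : Matrix (Fin n) (Fin n) ℂ := star hS.eigenvectorUnitary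
  set W : Matrix (Fin n) (Fin n) ℂ := star hT.eigenvectorUnitary
  -- `n - 1` linear equations put `x` in the span of the eigenvectors of `S` up to the index `i` and
  -- in the span of the eigenvectors of `T` from the index `i` on
  obtain ⟨x, hx0, hx⟩ : ∃ x : Fin n → ℂ, x ≠ 0 ∧ ∀ j, j ≠ i →
      (if e j < e i then (W *ᵥ x) j else (U *ᵥ x) j) = 0 := by
    let f : (Fin n → ℂ) →ₗ[ℂ] ({j // j ≠ i} → ℂ) := LinearMap.pi fun j =>
      if e j < e i then LinearMap.proj (j : Fin n) ∘ₗ W.mulVecLin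
        else LinearMap.proj (j : Fin n) ∘ₗ U.mulVecLin
    have hf : f.ker ≠ ⊥ := by
      refine LinearMap.ker_ne_bot_of_finrank_lt ?_
      rw [Module.finrank_fintype_fun_eq_card, Module.finrank_fintype_fun_eq_card]
      exact Fintype.card_subtype_lt (p := fun j => j ≠ i) (x := i) (by simp)
    obtain ⟨x, hx, hx0⟩ := Submodule.exists_mem_ne_zero_of_ne_bot hf
    refine ⟨x, hx0, fun j hj => ?_⟩
    have := congrFun (LinearMap.mem_ker.1 hx) ⟨j, hj⟩
    by_cases h : e j < e i
    · simpa [f, h] using this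
    · simpa [f, h] using this
  have hlow : hS.eigenvalues i * ∑ j, ‖(U *ᵥ x) j‖ ^ 2 ≤
      ∑ j, hS.eigenvalues j * ‖(U *ᵥ x) j‖ ^ 2 := by
    rw [Finset.mul_sum]
    refine Finset.sum_le_sum fun j _ => ?_
    rcases le_or_gt (e j) (e i) with h | h
    · exact mul_le_mul_of_nonneg_right (anti hS h) (by positivity)
    · have hz := hx j (by rintro rfl; exact lt_irrefl _ h)
      rw [if_neg h.not_gt] at hz
      simp [hz]
  have hup : ∑ j, hT.eigenvalues j * ‖(W *ᵥ x) j‖ ^ 2 ≤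
      hT.eigenvalues i * ∑ j, ‖(W *ᵥ x) j‖ ^ 2 := by
    rw [Finset.mul_sum]
    refine Finset.sum_le_sum fun j _ => ?_
    rcases le_or_gt (e i) (e j) with h | h
    · exact mul_le_mul_of_nonneg_right (anti hT h) (by positivity)
    · have hz := hx j (by rintro rfl; exact lt_irrefl _ h)
      rw [if_pos h] at hz
      simp [hz]
  have hmid : ∑ j, hS.eigenvalues j * ‖(U *ᵥ x) j‖ ^ 2 ≤
      ∑ j, hT.eigenvalues j * ‖(W *ᵥ x) j‖ ^ 2 := by
    have h := (Matrix.le_iff.1 hST).dotProduct_mulVec_nonneg x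
    rw [sub_mulVec, dotProduct_sub, sub_nonneg, hS.star_dotProduct_mulVec_eq_sum,
      hT.star_dotProduct_mulVec_eq_sum] at h
    exact Complex.real_le_real.1 h
  have hUW : ∑ j, ‖(U *ᵥ x) j‖ ^ 2 = ∑ j, ‖(W *ᵥ x) j‖ ^ 2 := Complex.ofReal_injective <|
    (hS.sum_norm_sq_eigenvectorUnitary_mulVec x).trans
      (hT.sum_norm_sq_eigenvectorUnitary_mulVec x).symm
  have hpos : 0 < ∑ j, ‖(W *ᵥ x) j‖ ^ 2 := by
    have h := Matrix.dotProduct_star_self_pos_iff.2 hx0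
    rw [← hT.sum_norm_sq_eigenvectorUnitary_mulVec x] at h
    exact_mod_cast h
  rw [hUW] at hlow
  exact le_of_mul_le_mul_right (hlow.trans (hmid.trans hup)) hpos

theorem IsUnitarilyInvariantNorm.exp_mono {N : Seminorm ℂ (Matrix (Fin n) (Fin n) ℂ)}
    (hN : IsUnitarilyInvariantNorm N) {S T : Matrix (Fin n) (Fin n) ℂ}
    (hS : S.IsHermitian) (hT : T.IsHermitian) (hST : S ≤ T) :
    N (NormedSpace.exp S) ≤ N (NormedSpace.exp T) := by
  rw [← CFC.real_exp_eq_normedSpace_exp hS, ← CFC.real_exp_eq_normedSpace_exp hT,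
    hN.apply_cfc hS, hN.apply_cfc hT]
  exact hN.diagonal_mono (fun i => (Real.exp_pos _).le)
    fun i => Real.exp_le_exp.2 (hS.eigenvalues_mono hT hST i)

end Weyl

/-! ### Means, exponentials and logarithms in a C⋆-algebra -/

section CStar

open scoped Ring

variable {𝒜 : Type*} [CStarAlgebra 𝒜] [PartialOrder 𝒜] [StarOrderedRing 𝒜]

theorem IsStrictlyPositive.convexComb {X Y : 𝒜} (hX : IsStrictlyPositive X)
    (hY : IsStrictlyPositive Y) {v : ℝ} (hv0 : 0 ≤ v) (hv1 : v ≤ 1) :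
    IsStrictlyPositive ((1 - v) • X + v • Y) := by
  rcases hv0.eq_or_lt with rfl | hv
  · simpa using hX
  · exact IsStrictlyPositive.nonneg_add (smul_nonneg (by linarith) hX.nonneg) (hY.smul hv)

theorem isStrictlyPositive_exp {S : 𝒜} (hS : IsSelfAdjoint S) :
    IsStrictlyPositive (NormedSpace.exp S) := by
  rw [← CFC.real_exp_eq_normedSpace_exp hS]
  exact (cfc_isStrictlyPositive_iff _ S).2 fun x _ => Real.exp_pos x

/-- The inequality `X ∇_v Y ≤ L (X !_v Y)` for `X = 1` and `Y = T`. -/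
theorem arith_one_le_smul_harm_one {T : 𝒜} (hT : IsStrictlyPositive T) {a b v : ℝ} (ha : 0 < a)
    (hab : a ≤ b) (hv0 : 0 ≤ v) (hv1 : v ≤ 1) (h1 : algebraMap ℝ 𝒜 (a / b) ≤ T)
    (h2 : T ≤ algebraMap ℝ 𝒜 (b / a)) :
    (1 - v) • (1 : 𝒜) + v • T ≤
      meanConst v a b • ((1 - v) • (1 : 𝒜) + v • T⁻¹ʳ)⁻¹ʳ := by
  have hTs : IsSelfAdjoint T := hT.isSelfAdjoint
  have hTpos : ∀ x ∈ spectrum ℝ T, 0 < x := fun x hx => hT.spectrum_pos hx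
  have hgpos : ∀ x ∈ spectrum ℝ T, 0 < scalarArith v 1 x⁻¹ := fun x hx => by
    have := inv_pos.2 (hTpos x hx)
    unfold scalarArith
    rcases hv0.eq_or_lt with rfl | hv
    · simp
    · nlinarith [mul_pos hv this]
  have hc1 : ContinuousOn (fun x => scalarArith v 1 x) (spectrum ℝ T) := by
    unfold scalarArith; fun_prop
  have hcinv : ContinuousOn (fun x : ℝ => x⁻¹) (spectrum ℝ T) :=
    continuousOn_id.inv₀ fun x hx => (hTpos x hx).ne'
  have hc2 : ContinuousOn (fun x => scalarArith v 1 x⁻¹) (spectrum ℝ T) := by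
    unfold scalarArith; fun_prop
  have hc3 : ContinuousOn (fun x => (scalarArith v 1 x⁻¹)⁻¹) (spectrum ℝ T) :=
    hc2.inv₀ fun x hx => (hgpos x hx).ne'
  have e1 : cfc (fun x => scalarArith v 1 x) T = (1 - v) • (1 : 𝒜) + v • T := by
    unfold scalarArith
    rw [cfc_add .., cfc_const .., cfc_const_mul .., cfc_id' ..]
    simp [Algebra.algebraMap_eq_smul_one]
  have einv : cfc (fun x : ℝ => x⁻¹) T = T⁻¹ʳ := by
    rw [cfc_inv (fun x => x) T fun x hx => (hTpos x hx).ne', cfc_id' ..]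
  have e2 : cfc (fun x => scalarArith v 1 x⁻¹) T = (1 - v) • (1 : 𝒜) + v • T⁻¹ʳ := by
    unfold scalarArith
    rw [cfc_add .., cfc_const .., cfc_const_mul .., einv]
    simp [Algebra.algebraMap_eq_smul_one]
  have e3 : cfc (fun x => (scalarArith v 1 x⁻¹)⁻¹) T =
      ((1 - v) • (1 : 𝒜) + v • T⁻¹ʳ)⁻¹ʳ := by
    rw [← e2, cfc_inv _ T fun x hx => (hgpos x hx).ne']
  rw [← e1, ← e3, ← cfc_smul ..]
  refine cfc_mono fun x hx => ?_
  rw [smul_eq_mul, ← div_eq_mul_inv, le_div_iff₀ (hgpos x hx)]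
  exact scalarArith_mul_le_meanConst hv0 hv1 ha hab
    ((algebraMap_le_iff_le_spectrum hTs).1 h1 x hx) ((le_algebraMap_iff_spectrum_le hTs).1 h2 x hx)

/-- Reverse of the inequality between the harmonic and the arithmetic mean. -/
theorem arith_le_smul_harm {X Y : 𝒜} (hX : IsStrictlyPositive X) (hY : IsStrictlyPositive Y)
    {a b v : ℝ} (ha : 0 < a) (hab : a ≤ b) (hv0 : 0 ≤ v) (hv1 : v ≤ 1)
    (haX : algebraMap ℝ 𝒜 a ≤ X) (hXb : X ≤ algebraMap ℝ 𝒜 b)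
    (haY : algebraMap ℝ 𝒜 a ≤ Y) (hYb : Y ≤ algebraMap ℝ 𝒜 b) :
    (1 - v) • X + v • Y ≤ meanConst v a b • ((1 - v) • X⁻¹ʳ + v • Y⁻¹ʳ)⁻¹ʳ := by
  have hb : 0 < b := ha.trans_le hab
  obtain ⟨T, hT⟩ : ∃ T, T = CFC.conjSqrt X⁻¹ʳ Y := ⟨_, rfl⟩
  have hYT : Y = CFC.conjSqrt X T := by rw [hT, CFC.conjSqrt_conjSqrt_ringInverse X Y hX]
  have hTpos : IsStrictlyPositive T :=
    hT ▸ (CFC.isStrictlyPositive_conjSqrt_iff _ _ hX.ringInverse).2 hY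
  have h1 : algebraMap ℝ 𝒜 (a / b) ≤ T := by
    have : (a / b) • X ≤ Y := by
      refine (smul_le_smul_of_nonneg_left hXb (by positivity)).trans (le_trans (le_of_eq ?_) haY)
      rw [Algebra.algebraMap_eq_smul_one, Algebra.algebraMap_eq_smul_one, smul_smul,
        div_mul_cancel₀ _ hb.ne']
    have := CFC.conjSqrt_le_conjSqrt (c := X⁻¹ʳ) this
    rwa [map_smul, CFC.conjSqrt_ringInverse_self X hX, ← hT,
      ← Algebra.algebraMap_eq_smul_one] at this
  have h2 : T ≤ algebraMap ℝ 𝒜 (b / a) := by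
    have : Y ≤ (b / a) • X := by
      refine hYb.trans (le_trans (le_of_eq ?_) (smul_le_smul_of_nonneg_left haX (by positivity)))
      rw [Algebra.algebraMap_eq_smul_one, Algebra.algebraMap_eq_smul_one, smul_smul,
        div_mul_cancel₀ _ ha.ne']
    have := CFC.conjSqrt_le_conjSqrt (c := X⁻¹ʳ) this
    rwa [map_smul, CFC.conjSqrt_ringInverse_self X hX, ← hT,
      ← Algebra.algebraMap_eq_smul_one] at this
  have hA : (1 - v) • X + v • Y = CFC.conjSqrt X ((1 - v) • (1 : 𝒜) + v • T) := by
    rw [map_add, map_smul, map_smul, CFC.conjSqrt_one X hX.nonneg, ← hYT]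
  have hH : ((1 - v) • X⁻¹ʳ + v • Y⁻¹ʳ)⁻¹ʳ =
      CFC.conjSqrt X ((1 - v) • (1 : 𝒜) + v • T⁻¹ʳ)⁻¹ʳ := by
    have hXX : X⁻¹ʳ⁻¹ʳ = X := Ring.inverse_inverse hX.isUnit
    have : (1 - v) • X⁻¹ʳ + v • Y⁻¹ʳ = CFC.conjSqrt X⁻¹ʳ ((1 - v) • (1 : 𝒜) + v • T⁻¹ʳ) := by
      rw [map_add, map_smul, map_smul, CFC.conjSqrt_one _ hX.ringInverse.nonneg,
        ← CFC.ringInverse_conjSqrt X T hX, ← hYT]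
    rw [this, CFC.ringInverse_conjSqrt _ _ hX.ringInverse, hXX]
  rw [hA, hH, ← map_smul]
  exact CFC.conjSqrt_le_conjSqrt (arith_one_le_smul_harm_one hTpos ha hab hv0 hv1 h1 h2)

/-- Operator concavity of the logarithm, at `exp S` and `exp T`. -/
theorem arith_le_log_arith_exp {S T : 𝒜} (hS : IsSelfAdjoint S) (hT : IsSelfAdjoint T) {v : ℝ}
    (hv0 : 0 ≤ v) (hv1 : v ≤ 1) :
    (1 - v) • S + v • T ≤ CFC.log ((1 - v) • NormedSpace.exp S + v • NormedSpace.exp T) := by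
  have h := CFC.concaveOn_log.2 (isStrictlyPositive_exp hS) (isStrictlyPositive_exp hT)
    (sub_nonneg.2 hv1) hv0 (by ring)
  rwa [CFC.log_exp S hS, CFC.log_exp T hT] at h

/-- The counterpart of `arith_le_log_arith_exp` for the harmonic mean, which is that inequality for
`-S` and `-T`. -/
theorem log_harm_exp_le_arith {S T : 𝒜} (hS : IsSelfAdjoint S) (hT : IsSelfAdjoint T) {v : ℝ}
    (hv0 : 0 ≤ v) (hv1 : v ≤ 1) :
    CFC.log ((1 - v) • (NormedSpace.exp S)⁻¹ʳ + v • (NormedSpace.exp T)⁻¹ʳ)⁻¹ʳ ≤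
      (1 - v) • S + v • T := by
  have hinv {R : 𝒜} : (NormedSpace.exp R)⁻¹ʳ = NormedSpace.exp (-R) := by
    let _ := NormedAlgebra.restrictScalars ℚ ℝ 𝒜
    exact Ring.inverse_exp R
  have h := arith_le_log_arith_exp hS.neg hT.neg hv0 hv1
  obtain ⟨Q, hQ⟩ : ∃ Q, Q = (1 - v) • NormedSpace.exp (-S) + v • NormedSpace.exp (-T) := ⟨_, rfl⟩
  have hQpos : IsStrictlyPositive Q := hQ ▸
    (isStrictlyPositive_exp hS.neg).convexComb (isStrictlyPositive_exp hT.neg) hv0 hv1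
  have hlog : CFC.log Q⁻¹ʳ = -CFC.log Q := by
    conv_lhs => rw [← CFC.exp_log Q hQpos, hinv]
    exact CFC.log_exp _ (IsSelfAdjoint.log).neg
  rw [hinv, hinv, ← hQ, hlog]
  rw [← hQ] at h
  rw [neg_le, neg_add, ← smul_neg, ← smul_neg]
  exact h

theorem rpow_eq_exp_smul_log {Z : 𝒜} (hZ : IsStrictlyPositive Z) (y : ℝ) :
    Z ^ y = NormedSpace.exp (y • CFC.log Z) := by
  have hZs : IsSelfAdjoint Z := hZ.isSelfAdjoint
  have hpos : ∀ x ∈ spectrum ℝ Z, 0 < x := fun x hx => hZ.spectrum_pos hx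
  have hc : ContinuousOn Real.log (spectrum ℝ Z) :=
    Real.continuousOn_log.mono fun x hx => (hpos x hx).ne'
  have hlog : y • CFC.log Z = cfc (fun x => y * Real.log x) Z := by
    rw [cfc_const_mul y Real.log Z hc, CFC.log]
  rw [CFC.rpow_eq_cfc_real hZ.nonneg, hlog, ← CFC.real_exp_eq_normedSpace_exp (cfc_predicate _ Z),
    ← cfc_comp' Real.exp (fun x => y * Real.log x) Z (by fun_prop) (continuousOn_const.mul hc)]
  refine cfc_congr fun x hx => ?_
  rw [Real.rpow_def_of_pos (hpos x hx), mul_comm]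

omit [PartialOrder 𝒜] [StarOrderedRing 𝒜] in
theorem exp_algebraMap_add (r : ℝ) (S : 𝒜) :
    NormedSpace.exp (algebraMap ℝ 𝒜 r + S) = Real.exp r • NormedSpace.exp S := by
  let _ := NormedAlgebra.restrictScalars ℚ ℝ 𝒜
  rw [NormedSpace.exp_add_of_commute (Algebra.commutes r S), ← NormedSpace.algebraMap_exp_comm,
    ← Real.exp_eq_exp_ℝ, Algebra.algebraMap_eq_smul_one, smul_one_mul]

theorem algebraMap_exp_le_exp {r : ℝ} {S : 𝒜} (hS : IsSelfAdjoint S)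
    (h : algebraMap ℝ 𝒜 r ≤ S) : algebraMap ℝ 𝒜 (Real.exp r) ≤ NormedSpace.exp S := by
  rw [← CFC.real_exp_eq_normedSpace_exp hS, algebraMap_le_cfc_iff ..]
  exact fun x hx => Real.exp_le_exp.2 ((algebraMap_le_iff_le_spectrum hS).1 h x hx)

theorem exp_le_algebraMap_exp {r : ℝ} {S : 𝒜} (hS : IsSelfAdjoint S)
    (h : S ≤ algebraMap ℝ 𝒜 r) : NormedSpace.exp S ≤ algebraMap ℝ 𝒜 (Real.exp r) := by
  rw [← CFC.real_exp_eq_normedSpace_exp hS, cfc_le_algebraMap_iff ..]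
  exact fun x hx => Real.exp_le_exp.2 ((le_algebraMap_iff_spectrum_le hS).1 h x hx)

/-- If `Z` lies between the harmonic and the arithmetic mean of `exp S` and `exp T`, then `log Z`
differs from `S ∇_v T` by at most `log L` in the Loewner order. -/
theorem log_mean_exp_sub_arith_bounds {S T Z : 𝒜} (hS : IsSelfAdjoint S) (hT : IsSelfAdjoint T)
    {a b v : ℝ} (hab : a ≤ b) (hv0 : 0 ≤ v) (hv1 : v ≤ 1)
    (haS : algebraMap ℝ 𝒜 a ≤ S) (hSb : S ≤ algebraMap ℝ 𝒜 b)
    (haT : algebraMap ℝ 𝒜 a ≤ T) (hTb : T ≤ algebraMap ℝ 𝒜 b) (hZ : IsStrictlyPositive Z)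
    (hHZ : ((1 - v) • (NormedSpace.exp S)⁻¹ʳ + v • (NormedSpace.exp T)⁻¹ʳ)⁻¹ʳ ≤ Z)
    (hZP : Z ≤ (1 - v) • NormedSpace.exp S + v • NormedSpace.exp T) :
    CFC.log Z ≤
        algebraMap ℝ 𝒜 (Real.log (meanConst v (Real.exp a) (Real.exp b))) +
          ((1 - v) • S + v • T) ∧
      (1 - v) • S + v • T ≤
        algebraMap ℝ 𝒜 (Real.log (meanConst v (Real.exp a) (Real.exp b))) + CFC.log Z := by
  have hX := isStrictlyPositive_exp hS
  have hY := isStrictlyPositive_exp hT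
  have hP := hX.convexComb hY hv0 hv1
  have hH := (hX.ringInverse.convexComb hY.ringInverse hv0 hv1).ringInverse
  have hL := meanConst_pos hv0 hv1 (Real.exp_pos a) (Real.exp_le_exp.2 hab)
  have hPH := arith_le_smul_harm hX hY (Real.exp_pos a) (Real.exp_le_exp.2 hab) hv0 hv1
    (algebraMap_exp_le_exp hS haS) (exp_le_algebraMap_exp hS hSb)
    (algebraMap_exp_le_exp hT haT) (exp_le_algebraMap_exp hT hTb)
  constructor
  · calc CFC.log Z ≤ CFC.log (meanConst v (Real.exp a) (Real.exp b) •
          ((1 - v) • (NormedSpace.exp S)⁻¹ʳ + v • (NormedSpace.exp T)⁻¹ʳ)⁻¹ʳ) :=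
        CFC.log_le_log (hZP.trans hPH) hZ
      _ ≤ _ := by
        rw [CFC.log_smul' _ hL hH]
        exact add_le_add_right (log_harm_exp_le_arith hS hT hv0 hv1) _
  · calc (1 - v) • S + v • T ≤ CFC.log ((1 - v) • NormedSpace.exp S + v • NormedSpace.exp T) :=
        arith_le_log_arith_exp hS hT hv0 hv1
      _ ≤ CFC.log (meanConst v (Real.exp a) (Real.exp b) • Z) :=
        CFC.log_le_log (hPH.trans (smul_le_smul_of_nonneg_left hHZ hL.le)) hP
      _ = _ := CFC.log_smul' Z hL hZ

end CStar

/-! ### Norms of powers of means of exponentials -/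

section Matrix

open scoped Matrix.Norms.L2Operator

variable {n : ℕ}

theorem posDef_exp_smul {C : Matrix (Fin n) (Fin n) ℂ} {m : ℝ}
    (hC : m • (1 : Matrix (Fin n) (Fin n) ℂ) ≤ C) (p : ℝ) :
    (NormedSpace.exp (p • C)).PosDef :=
  Matrix.isStrictlyPositive_iff_posDef.1 <| isStrictlyPositive_exp <|
    (IsSelfAdjoint.all p).smul (IsSelfAdjoint.of_ge hC ((IsSelfAdjoint.all m).smul (.one _)))

/-- The two norm inequalities for any matrix `Z` between the harmonic and the arithmetic mean. -/
theorem IsUnitarilyInvariantNorm.rpow_mean_exp_bounds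
    {N : Seminorm ℂ (Matrix (Fin n) (Fin n) ℂ)} (hN : IsUnitarilyInvariantNorm N)
    {A B Z : Matrix (Fin n) (Fin n) ℂ} {m M v p : ℝ} (hmM : m ≤ M)
    (hmA : m • (1 : Matrix (Fin n) (Fin n) ℂ) ≤ A) (hAM : A ≤ M • (1 : Matrix (Fin n) (Fin n) ℂ))
    (hmB : m • (1 : Matrix (Fin n) (Fin n) ℂ) ≤ B) (hBM : B ≤ M • (1 : Matrix (Fin n) (Fin n) ℂ))
    (hv0 : 0 ≤ v) (hv1 : v ≤ 1) (hp : 0 < p)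
    (hHZ : matHarm v (NormedSpace.exp (p • A)) (NormedSpace.exp (p • B)) ≤ Z)
    (hZP : Z ≤ matArith v (NormedSpace.exp (p • A)) (NormedSpace.exp (p • B))) :
    meanConst v (Real.exp (p * m)) (Real.exp (p * M)) ^ (-(1 / p)) *
          N (NormedSpace.exp (matArith v A B)) ≤ N (Z ^ (1 / p)) ∧
      N (Z ^ (1 / p)) ≤ meanConst v (Real.exp (p * m)) (Real.exp (p * M)) ^ (1 / p) *
          N (NormedSpace.exp (matArith v A B)) := by
  have hsc (c : ℝ) : algebraMap ℝ (Matrix (Fin n) (Fin n) ℂ) c = c • 1 :=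
    Algebra.algebraMap_eq_smul_one c
  have hA : IsSelfAdjoint A := IsSelfAdjoint.of_ge hmA ((IsSelfAdjoint.all m).smul (.one _))
  have hB : IsSelfAdjoint B := IsSelfAdjoint.of_ge hmB ((IsSelfAdjoint.all m).smul (.one _))
  have hpA : IsSelfAdjoint (p • A) := (IsSelfAdjoint.all p).smul hA
  have hpB : IsSelfAdjoint (p • B) := (IsSelfAdjoint.all p).smul hB
  have low {C : Matrix (Fin n) (Fin n) ℂ} (h : m • (1 : Matrix (Fin n) (Fin n) ℂ) ≤ C) :
      algebraMap ℝ _ (p * m) ≤ p • C := by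
    rw [hsc, mul_smul]
    exact smul_le_smul_of_nonneg_left h hp.le
  have high {C : Matrix (Fin n) (Fin n) ℂ} (h : C ≤ M • (1 : Matrix (Fin n) (Fin n) ℂ)) :
      p • C ≤ algebraMap ℝ _ (p * M) := by
    rw [hsc, mul_smul]
    exact smul_le_smul_of_nonneg_left h hp.le
  simp only [matHarm, Matrix.nonsing_inv_eq_ringInverse] at hHZ
  have hZ : IsStrictlyPositive Z :=
    ((isStrictlyPositive_exp hpA).ringInverse.convexComb (isStrictlyPositive_exp hpB).ringInverse
      hv0 hv1).ringInverse.of_le hHZ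
  have hab : p * m ≤ p * M := mul_le_mul_of_nonneg_left hmM hp.le
  obtain ⟨h1, h2⟩ := log_mean_exp_sub_arith_bounds hpA hpB hab hv0 hv1 (low hmA) (high hAM)
    (low hmB) (high hBM) hZ hHZ hZP
  have hL := meanConst_pos hv0 hv1 (Real.exp_pos (p * m)) (Real.exp_le_exp.2 hab)
  set L := meanConst v (Real.exp (p * m)) (Real.exp (p * M))
  have hD : (1 - v) • p • A + v • p • B = p • matArith v A B := by
    rw [matArith, smul_add, smul_comm p, smul_comm p]
  have hDs : IsSelfAdjoint (matArith v A B) :=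
    ((IsSelfAdjoint.all (1 - v)).smul hA).add ((IsSelfAdjoint.all v).smul hB)
  have hWs : IsSelfAdjoint ((1 / p) • CFC.log Z) := (IsSelfAdjoint.all _).smul IsSelfAdjoint.log
  have hcs : IsSelfAdjoint (algebraMap ℝ (Matrix (Fin n) (Fin n) ℂ) (1 / p * Real.log L)) :=
    IsSelfAdjoint.algebraMap _ (IsSelfAdjoint.all _)
  have hexp : Real.exp (1 / p * Real.log L) = L ^ (1 / p) := by
    rw [Real.rpow_def_of_pos hL, mul_comm]
  have hpD : (1 / p) • p • matArith v A B = matArith v A B := by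
    rw [smul_smul, one_div_mul_cancel hp.ne', one_smul]
  rw [hD] at h1 h2
  -- a scalar summand in the exponent becomes a scalar factor of the norm
  have scale (S : Matrix (Fin n) (Fin n) ℂ) :
      N (NormedSpace.exp (algebraMap ℝ _ (1 / p * Real.log L) + S)) =
        L ^ (1 / p) * N (NormedSpace.exp S) := by
    rw [exp_algebraMap_add, hexp, ← Complex.coe_smul, map_smul_eq_mul, Complex.norm_real,
      Real.norm_of_nonneg (Real.rpow_nonneg hL.le _)]
  have h1' : (1 / p) • CFC.log Z ≤ algebraMap ℝ _ (1 / p * Real.log L) + matArith v A B := by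
    refine (smul_le_smul_of_nonneg_left h1 (by positivity : (0 : ℝ) ≤ 1 / p)).trans (le_of_eq ?_)
    rw [smul_add, hpD, hsc, hsc, mul_smul]
  have h2' : matArith v A B ≤ algebraMap ℝ _ (1 / p * Real.log L) + (1 / p) • CFC.log Z := by
    refine le_trans (le_of_eq hpD.symm)
      ((smul_le_smul_of_nonneg_left h2 (by positivity : (0 : ℝ) ≤ 1 / p)).trans (le_of_eq ?_))
    rw [smul_add, hsc, hsc, mul_smul]
  have hpow : Z ^ (1 / p) = NormedSpace.exp ((1 / p) • CFC.log Z) := rpow_eq_exp_smul_log hZ _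
  rw [hpow]
  constructor
  · rw [Real.rpow_neg hL.le, inv_mul_le_iff₀ (Real.rpow_pos_of_pos hL _), ← scale]
    exact hN.exp_mono hDs (hcs.add hWs) h2'
  · rw [← scale]
    exact hN.exp_mono hWs (hcs.add hDs) h1'

end Matrix

theorem mainTheorem4 {n : ℕ} (A B : Matrix (Fin n) (Fin n) ℂ) (m M v p : ℝ)
    (hm : 0 < m) (hmM : m < M)
    (hmA : m • (1 : Matrix (Fin n) (Fin n) ℂ) ≤ A) (hAM : A ≤ M • (1 : Matrix (Fin n) (Fin n) ℂ))
    (hmB : m • (1 : Matrix (Fin n) (Fin n) ℂ) ≤ B) (hBM : B ≤ M • (1 : Matrix (Fin n) (Fin n) ℂ))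
    (hv0 : 0 ≤ v) (hv1 : v ≤ 1) (hp : 0 < p)
    (σ : Matrix (Fin n) (Fin n) ℂ → Matrix (Fin n) (Fin n) ℂ → Matrix (Fin n) (Fin n) ℂ)
    (hσ : IsOperatorMean σ) (hσv : IsBetweenHarmArith v σ)
    (N : Seminorm ℂ (Matrix (Fin n) (Fin n) ℂ)) (hN : IsUnitarilyInvariantNorm N) :
    meanConst v (Real.exp (p * m)) (Real.exp (p * M)) ^ (-(1 / p)) *
          N (NormedSpace.exp (matArith v A B)) ≤
        N (σ (NormedSpace.exp (p • A)) (NormedSpace.exp (p • B)) ^ (1 / p)) ∧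
      N (σ (NormedSpace.exp (p • A)) (NormedSpace.exp (p • B)) ^ (1 / p)) ≤
        meanConst v (Real.exp (p * m)) (Real.exp (p * M)) ^ (1 / p) *
          N (NormedSpace.exp (matArith v A B)) := by
  obtain ⟨hHZ, hZP⟩ := hσv _ _ (posDef_exp_smul hmA p) (posDef_exp_smul hmB p)
  exact hN.rpow_mean_exp_bounds hmM.le hmA hAM hmB hBM hv0 hv1 hp hHZ hZP
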